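/- Let $V_{\rm LJ}(r)=r^{-12}-2r^{-6}$ for $r>0$ (and $V_{\rm LJ}(0)=+\infty$) be the Lennard-Jones pair potential on $\mathbb{R}^3$, and for $a>0$ let $V_a(r)=V_{\rm LJ}(r)$ if $r>a$ and $V_a(r)=V_{\rm LJ}(a)$ if $r\le a$. The potential $V_{\rm LJ}$ is stable; let $B_{\rm LJ}$ be its stability constant, i.e. the least real number $B$ such that $\sum_{1\le i<j\le N}V_{\rm LJ}(|x_i-x_j|)\ge -BN$ for all $N$ and all $x_1,\dots,x_N\in\mathbb{R}^3$. For $\beta>0$, a measurable set $\Lambda\subset\mathbb{R}^3$ of finite positive volume $|\Lambda|$ (for instance a cubic box) and $n\ge1$, let $$C_n(\beta,\Lambda)=\frac1{|\Lambda|}\frac1{n!}\int_\Lambda\!\!\cdots\!\int_\Lambda\ \sum_{g\in G_n}\ \prod_{\{i,j\}\in E_g}\left[e^{-\beta V_{\rm LJ}(|x_i-x_j|)}-1\right]dx_1\cdots dx_n$$ be the $n$-th Mayer coefficient, where $G_n$ is the set of connected graphs on the vertex set $\{1,\dots,n\}$ and $E_g$ is the edge set of $g$ (so $C_1(\beta,\Lambda)=1$).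 Then there is $a\in(0,2^{-1/6})$, and in fact one can take $a=0.3637$, such that for every $\beta>0$ the integral $$\tilde C(\beta)=\int_{\mathbb{R}^3}\left[\left|e^{-\beta[V_{\rm LJ}(|x|)-V_a(|x|)]}-1\right|+\beta|V_a(|x|)|\right]dx$$ is finite and, for all such $\Lambda$ and all $n\ge1$ (the integral defining $C_n(\beta,\Lambda)$ being absolutely convergent), $$|C_n(\beta,\Lambda)|\le e^{\beta B_{\rm LJ}n}\,n^{n-2}\,\frac{[\tilde C(\beta)]^{n-1}}{n!}.$$ Consequently, for every complex $\lambda$ with $|\lambda|<\dfrac1{e^{\beta B_{\rm LJ}+1}\tilde C(\beta)}$ the Mayer series $\sum_{n\ge1}C_n(\beta,\Lambda)\lambda^n$ converges absolutely, uniformly in $\Lambda$: there is a summable sequence $(M_n)_{n\ge1}$, independent of $\Lambda$, with $|C_n(\beta,\Lambda)\lambda^n|\le M_n$ for all $n\ge 1$ and all $\Lambda$. -/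

import Mathlib

open MeasureTheory

noncomputable section

/-- Physical space `ℝ³` with its Euclidean norm. -/
abbrev Space : Type := EuclideanSpace ℝ (Fin 3)

/-- The Lennard-Jones potential as a function of the distance `r > 0`. Mathematically it is `+∞`
at `r = 0`; the value at `r = 0` (here `0`) is never used: energies are taken at pairwise distinct
points, and in the integrals coinciding points form a null set. -/
def lennardJones (r : ℝ) : ℝ := 1 / r ^ 12 - 2 / r ^ 6

/-- The Lennard-Jones potential cut off at distance `a`: constant on `r ≤ a`. -/
def cutoffLJ (a r : ℝ) : ℝ := if a < r then lennardJones r else lennardJones a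

/-- The energy `∑_{i < j} V(|x_i - x_j|)` of `N` particles. -/
def configEnergy (V : ℝ → ℝ) {N : ℕ} (x : Fin N → Space) : ℝ :=
  ∑ p : Fin N × Fin N with p.1 < p.2, V ‖x p.1 - x p.2‖

/-- The constants `B` with `U(x_1, …, x_N) ≥ - B N` for all `N` and all configurations of the
Lennard-Jones potential; configurations with coinciding points have energy `+∞`, so that
only pairwise distinct points matter. -/
def ljStabilityBounds : Set ℝ :=
  {B : ℝ | ∀ (N : ℕ) (x : Fin N → Space), Function.Injective x →
    -(B * N) ≤ configEnergy lennardJones x}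

/-- The stability constant of the Lennard-Jones potential. -/
def ljStabilityConst : ℝ := sInf ljStabilityBounds

open Classical in
/-- The sum over connected graphs `g` on `n` vertices of
`∏_{{i, j} ∈ E(g)} (exp (- β V(|x_i - x_j|)) - 1)`. -/
def mayerIntegrand (V : ℝ → ℝ) (β : ℝ) (n : ℕ) (x : Fin n → Space) : ℝ :=
  ∑ g : SimpleGraph (Fin n) with g.Connected,
    ∏ p : Fin n × Fin n with p.1 < p.2 ∧ g.Adj p.1 p.2,
      (Real.exp (-β * V ‖x p.1 - x p.2‖) - 1)

/-- The `n`-th Mayer coefficient `C_n(β, Λ)` of the pair potential `V`, for `n ≥ 1`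
(for `n = 1` the only connected graph has no edge, and `C_1 = 1`). -/
def mayerCoeff (V : ℝ → ℝ) (β : ℝ) (Λ : Set Space) (n : ℕ) : ℝ :=
  1 / volume.real Λ * (1 / (n.factorial : ℝ)) *
    ∫ x in Set.univ.pi (fun _ : Fin n => Λ), mayerIntegrand V β n x

/-- The integrand of `C̃(β)`. -/
def ctildeIntegrand (a β : ℝ) (x : Space) : ℝ :=
  |Real.exp (-β * (lennardJones ‖x‖ - cutoffLJ a ‖x‖)) - 1| + β * |cutoffLJ a ‖x‖|

/-- `C̃(β)`, the integral over `ℝ³`. -/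
def ctilde (a β : ℝ) : ℝ := ∫ x : Space, ctildeIntegrand a β x

end

/-!
The bound on the Mayer coefficients rests on a tree-graph inequality in the form of Procacci and
Yuhjtman: for pairwise distinct points, with `v e = β V(|x_i - x_j|)` for a pair `e = {i, j}`,
`|∑_{g connected} ∏_{e ∈ g} (exp (-v e) - 1)| ≤ exp (β B n) ∑_{τ tree} ∏_{e ∈ τ} (1 - exp (-|v e|))`,
where `B` is the stability constant of `V` itself. It is `abs_connectedSum_bot_le`.

Its proof groups the connected graphs by their minimal spanning tree for the weight `v`. In Kruskal's
algorithm the pairs are examined in increasing order of `v`. A pair inside a component of the current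
forest may be added or not, which gives the factor `1 + (exp (-v e) - 1) = exp (-v e)`; a pair between
two components is either omitted or joins the tree with the factor `exp (-v e) - 1`, which is, in
absolute value, `1 - exp (-|v e|)` times `exp (-v e)` when `v e < 0`. Consider the forest at
the moment when `v` turns nonnegative. Each pair internal to one of its components has contributed, or
will contribute, its exponential, except for negative pairs that were examined and omitted before a
merger made them internal; adding their energy only lowers the total. All other factors are at most
`1`, so the exponentials amount to at most `exp (- energy inside the components)`; by stability, applied
to each component, this is at most `exp (β B n)`.

Splitting the potential at the cutoff enters only at the end: `1 - exp (-|β V|)` is at most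
`|exp (-β (V - V_a)) - 1| + β |V_a|` pointwise whenever `2 a ^ 6 ≤ 1`
(`one_sub_exp_le_ctildeIntegrand`). The integral over `Λ ^ n` of the product over a tree is at most
`|Λ| C̃ ^ (n - 1)`, integrating out the leaves first (`lintegral_prod_tree_le`), and there are at most
`n ^ (n - 2)` trees. The last fact is proved by Pitman's double counting of rooted forests
(`card_rootedForests_le`), where a rooted forest is encoded as the map from a vertex to its parent.

Stability of the Lennard-Jones potential (`ljStabilityBounds_nonempty`) is an induction on the number of
particles: a particle at the minimal distance `r` from another one has energy at least
`r ^ (-12) - 2 c r ^ (-6)`, because the other points are `r`-separated, and this is at least `-c ^ 2`.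
-/

/-! ### The tree-graph inequality -/

/-- The graph whose edges are the pairs in `F`, orientation and loops being forgotten. -/
def pairGraph {α : Type*} (F : Finset (α × α)) : SimpleGraph α :=
  SimpleGraph.fromRel fun a b => (a, b) ∈ F

theorem pairGraph_adj {α : Type*} {F : Finset (α × α)} {a b : α} :
    (pairGraph F).Adj a b ↔ a ≠ b ∧ ((a, b) ∈ F ∨ (b, a) ∈ F) := Iff.rfl

theorem pairGraph_empty {α : Type*} : pairGraph (∅ : Finset (α × α)) = ⊥ := by
  ext a b; simp [pairGraph_adj]

theorem pairGraph_insert {α : Type*} [DecidableEq α] (e : α × α) (F : Finset (α × α)) :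
    pairGraph (insert e F) = SimpleGraph.edge e.1 e.2 ⊔ pairGraph F := by
  obtain ⟨x, y⟩ := e
  ext a b
  simp only [pairGraph_adj, SimpleGraph.sup_adj, SimpleGraph.edge_adj, Finset.mem_insert,
    Prod.mk.injEq]
  tauto

theorem sup_pairGraph_insert {α : Type*} [DecidableEq α] (T : SimpleGraph α) (e : α × α)
    (F : Finset (α × α)) :
    T ⊔ pairGraph (insert e F) = (T ⊔ SimpleGraph.edge e.1 e.2) ⊔ pairGraph F := by
  rw [pairGraph_insert, sup_assoc]

theorem connected_of_forall_adj_reachable {α : Type*} {G H : SimpleGraph α} (hG : G.Connected)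
    (h : ∀ a b, G.Adj a b → H.Reachable a b) : H.Connected := by
  have := hG.nonempty
  refine ⟨fun a b => ?_⟩
  obtain ⟨w⟩ := hG.preconnected a b
  induction w with
  | nil => rfl
  | cons hab _ ih => exact (h _ _ hab).trans ih

/-- An edge whose endpoints are already joined does not affect connectedness. -/
theorem connected_sup_edge_sup_iff {α : Type*} {T : SimpleGraph α} {x y : α}
    (h : T.Reachable x y) (G : SimpleGraph α) :
    ((T ⊔ SimpleGraph.edge x y) ⊔ G).Connected ↔ (T ⊔ G).Connected := by
  constructor
  · refine fun hc => connected_of_forall_adj_reachable hc fun a b hab => ?_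
    have hxy : (T ⊔ G).Reachable x y := h.mono le_sup_left
    rcases hab with (hT | he) | hG
    · exact SimpleGraph.Adj.reachable (Or.inl hT)
    · rw [SimpleGraph.edge_adj] at he
      rcases he.1 with ⟨rfl, rfl⟩ | ⟨rfl, rfl⟩
      exacts [hxy, hxy.symm]
    · exact SimpleGraph.Adj.reachable (Or.inr hG)
  · exact fun hc => hc.mono (sup_le_sup_right le_sup_left _)

open Classical in
/-- The sum, over the sets `F` of pairs from `L` that complete `T` to a connected graph, of the
product of the Mayer factors `exp (- v e) - 1`. -/
noncomputable def connectedSum {α : Type*} (v : α × α → ℝ) (T : SimpleGraph α)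
    (L : Finset (α × α)) : ℝ :=
  ∑ F ∈ L.powerset, if (T ⊔ pairGraph F).Connected then ∏ e ∈ F, (Real.exp (-v e) - 1) else 0

open Classical in
/-- The sum, over the sets `F` of pairs from `L` that complete `T` to a tree, of the product of the
factors `1 - exp (- |v e|)`. -/
noncomputable def treeSum {α : Type*} (v : α × α → ℝ) (T : SimpleGraph α)
    (L : Finset (α × α)) : ℝ :=
  ∑ F ∈ L.powerset, if (T ⊔ pairGraph F).IsTree then ∏ e ∈ F, (1 - Real.exp (-|v e|)) else 0

open Classical in
/-- The energy of those pairs of `L` whose endpoints lie in the same component of `T`. -/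
noncomputable def internalEnergy {α : Type*} (v : α × α → ℝ) (L : Finset (α × α))
    (T : SimpleGraph α) : ℝ :=
  ∑ e ∈ L, if T.Reachable e.1 e.2 then v e else 0

open Classical in
theorem connectedSum_eq_sum_filter {α : Type*} (v : α × α → ℝ) (T : SimpleGraph α)
    (L : Finset (α × α)) :
    connectedSum v T L = ∑ F ∈ L.powerset with (T ⊔ pairGraph F).Connected,
      ∏ e ∈ F, (Real.exp (-v e) - 1) :=
  (Finset.sum_filter _ _).symm

open Classical in
theorem treeSum_eq_sum_filter {α : Type*} (v : α × α → ℝ) (T : SimpleGraph α)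
    (L : Finset (α × α)) :
    treeSum v T L = ∑ F ∈ L.powerset with (T ⊔ pairGraph F).IsTree,
      ∏ e ∈ F, (1 - Real.exp (-|v e|)) :=
  (Finset.sum_filter _ _).symm

open Classical in
theorem internalEnergy_eq_sum_filter {α : Type*} (v : α × α → ℝ) (L : Finset (α × α))
    (T : SimpleGraph α) : internalEnergy v L T = ∑ e ∈ L with T.Reachable e.1 e.2, v e :=
  (Finset.sum_filter _ _).symm

theorem one_sub_exp_neg_abs_nonneg (x : ℝ) : 0 ≤ 1 - Real.exp (-|x|) := by
  have := Real.exp_le_one_iff.2 (neg_nonpos.2 (abs_nonneg x)); linarith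

theorem treeSum_nonneg {α : Type*} (v : α × α → ℝ) (T : SimpleGraph α) (L : Finset (α × α)) :
    0 ≤ treeSum v T L := by
  refine Finset.sum_nonneg fun F _ => ?_
  split_ifs
  · exact Finset.prod_nonneg fun e _ => one_sub_exp_neg_abs_nonneg _
  · exact le_rfl

theorem connectedSum_sup_edge {α : Type*} {v : α × α → ℝ} {T : SimpleGraph α} {e : α × α}
    {L : Finset (α × α)} (h : T.Reachable e.1 e.2) :
    connectedSum v (T ⊔ SimpleGraph.edge e.1 e.2) L = connectedSum v T L := by
  classical
  unfold connectedSum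
  exact Finset.sum_congr rfl fun F _ => if_congr (connected_sup_edge_sup_iff h _) rfl rfl

theorem internalEnergy_mono {α : Type*} {v : α × α → ℝ} {L : Finset (α × α)} (hL : ∀ e ∈ L, 0 ≤ v e)
    {T T' : SimpleGraph α} (h : T ≤ T') :
    internalEnergy v L T ≤ internalEnergy v L T' := by
  refine Finset.sum_le_sum fun e he => ?_
  by_cases h1 : T.Reachable e.1 e.2
  · simp [h1, h1.mono h]
  · rw [if_neg h1]
    split_ifs
    exacts [hL e he, le_rfl]

section Insert

variable {α : Type*} [DecidableEq α] {v : α × α → ℝ} {T : SimpleGraph α} {e : α × α}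
  {L : Finset (α × α)}

theorem connectedSum_insert (he : e ∉ L) :
    connectedSum v T (insert e L) = connectedSum v T L +
      (Real.exp (-v e) - 1) * connectedSum v (T ⊔ SimpleGraph.edge e.1 e.2) L := by
  classical
  unfold connectedSum
  rw [Finset.sum_powerset_insert he, Finset.mul_sum]
  congr 1
  refine Finset.sum_congr rfl fun F hF => ?_
  have heF : e ∉ F := fun h => he (Finset.mem_powerset.1 hF h)
  rw [sup_pairGraph_insert, Finset.prod_insert heF, mul_ite, mul_zero]

theorem treeSum_insert (he : e ∉ L) :
    treeSum v T (insert e L) = treeSum v T L +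
      (1 - Real.exp (-|v e|)) * treeSum v (T ⊔ SimpleGraph.edge e.1 e.2) L := by
  classical
  unfold treeSum
  rw [Finset.sum_powerset_insert he, Finset.mul_sum]
  congr 1
  refine Finset.sum_congr rfl fun F hF => ?_
  have heF : e ∉ F := fun h => he (Finset.mem_powerset.1 hF h)
  rw [sup_pairGraph_insert, Finset.prod_insert heF, mul_ite, mul_zero]

open Classical in
theorem internalEnergy_insert (he : e ∉ L) (T : SimpleGraph α) :
    internalEnergy v (insert e L) T =
      (if T.Reachable e.1 e.2 then v e else 0) + internalEnergy v L T := by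
  unfold internalEnergy
  rw [Finset.sum_insert he]

/-- The tree-graph inequality in the form that is proved by induction: pairs are inserted in order of
decreasing `v`, so that the recursion, read from the outside, is Kruskal's algorithm with current
forest `T`. The function `K` bounds the exponent; it dominates minus the energy internal to the
components, and it decreases when components merge. -/
theorem abs_connectedSum_le (v : α × α → ℝ) (L : Finset (α × α)) :
    ∀ (K : SimpleGraph α → ℝ), (∀ T, -internalEnergy v L T ≤ K T) → Antitone K →
      ∀ T : SimpleGraph α, T.IsAcyclic →
        |connectedSum v T L| ≤ Real.exp (K T) * treeSum v T L := by
  classical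
  refine Finset.induction_on_min_value v L ?_ ?_
  · intro K hK _ T hT
    have h0 : 0 ≤ K T := by simpa [internalEnergy] using hK T
    have h1 : 1 ≤ Real.exp (K T) := Real.one_le_exp h0
    by_cases hc : T.Connected
    · have ht : T.IsTree := ⟨hc, hT⟩
      simpa [connectedSum, treeSum, pairGraph_empty, hc, ht] using h1
    · have ht : ¬ T.IsTree := fun h => hc h.1
      simp [connectedSum, treeSum, pairGraph_empty, hc, ht]
  · intro e L he hmin ih K hK hanti T hT
    set h : ℝ := 1 - Real.exp (-|v e|) with hh
    have hh0 : 0 ≤ h := one_sub_exp_neg_abs_nonneg _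
    -- The exponent for the remaining pairs. Once `v e` is nonnegative, so are all later pairs, and
    -- their internal energy itself is monotone; before that, `v e` is charged when it is internal.
    obtain ⟨K', hK', hanti', hin, hout⟩ : ∃ K' : SimpleGraph α → ℝ,
        (∀ T, -internalEnergy v L T ≤ K' T) ∧ Antitone K' ∧
        (∀ T : SimpleGraph α, T.Reachable e.1 e.2 → -v e + K' T ≤ K T) ∧
        (∀ T : SimpleGraph α, ¬ T.Reachable e.1 e.2 → K' T ≤ K T ∧
          |Real.exp (-v e) - 1| * Real.exp (K' (T ⊔ SimpleGraph.edge e.1 e.2)) ≤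
            h * Real.exp (K T)) := by
      rcases le_or_gt 0 (v e) with hv | hv
      · have hL : ∀ x ∈ L, 0 ≤ v x := fun x hx => hv.trans (hmin x hx)
        refine ⟨fun T => -internalEnergy v L T, fun T => le_rfl,
          fun T T' hTT => neg_le_neg (internalEnergy_mono hL hTT), fun T hr => ?_, fun T hr => ?_⟩
        · have := hK T
          rw [internalEnergy_insert he, if_pos hr] at this
          linarith
        · have h1 := hK T
          rw [internalEnergy_insert he, if_neg hr, zero_add] at h1
          refine ⟨h1, ?_⟩
          have h2 : |Real.exp (-v e) - 1| = h := by
            rw [abs_sub_comm, hh, abs_of_nonneg hv, abs_of_nonneg]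
            simpa [abs_of_nonneg hv] using one_sub_exp_neg_abs_nonneg (v e)
          rw [h2]
          have h3 : internalEnergy v L T ≤
              internalEnergy v L (T ⊔ SimpleGraph.edge e.1 e.2) :=
            internalEnergy_mono hL le_sup_left
          gcongr
          linarith
      · refine ⟨fun T => K T + if T.Reachable e.1 e.2 then v e else 0, fun T => ?_, ?_,
          fun T hr => ?_, fun T hr => ⟨?_, ?_⟩⟩
        · have := hK T
          rw [internalEnergy_insert he] at this
          linarith
        · intro T T' hTT
          have := hanti hTT
          by_cases hr : T.Reachable e.1 e.2
          · simpa [hr, hr.mono hTT] using this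
          · simp only [if_neg hr]
            split_ifs <;> linarith
        · simp [hr]
        · simp [hr]
        · have hr' : (T ⊔ SimpleGraph.edge e.1 e.2).Reachable e.1 e.2 := by
            by_cases hne : e.1 = e.2
            · exact hne ▸ SimpleGraph.Reachable.refl _
            · exact SimpleGraph.Adj.reachable (Or.inr (by simp [SimpleGraph.edge_adj, hne]))
          have h2 : |Real.exp (-v e) - 1| = h * Real.exp (-v e) := by
            rw [abs_of_nonneg (sub_nonneg.2 (Real.one_le_exp (by linarith))), hh,
              abs_of_neg hv, neg_neg, sub_mul, one_mul, ← Real.exp_add]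
            simp
          rw [h2, mul_assoc, ← Real.exp_add]
          have := hanti (le_sup_left : T ≤ T ⊔ SimpleGraph.edge e.1 e.2)
          simp only [hr', if_true]
          gcongr
          linarith
    have ih' := ih K' hK' hanti'
    rw [connectedSum_insert he, treeSum_insert he]
    by_cases hr : T.Reachable e.1 e.2
    · rw [connectedSum_sup_edge hr]
      have e1 : connectedSum v T L + (Real.exp (-v e) - 1) * connectedSum v T L =
          Real.exp (-v e) * connectedSum v T L := by ring
      rw [e1, abs_mul, Real.abs_exp]
      calc Real.exp (-v e) * |connectedSum v T L|
          ≤ Real.exp (-v e) * (Real.exp (K' T) * treeSum v T L) := by gcongr; exact ih' T hT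
        _ = Real.exp (-v e + K' T) * treeSum v T L := by rw [Real.exp_add]; ring
        _ ≤ Real.exp (K T) * treeSum v T L := by
          gcongr
          · exact treeSum_nonneg _ _ _
          · exact hin T hr
        _ ≤ _ := by
          gcongr
          exact le_add_of_nonneg_right (mul_nonneg hh0 (treeSum_nonneg _ _ _))
    · obtain ⟨ho1, ho2⟩ := hout T hr
      have hT' : (T ⊔ SimpleGraph.edge e.1 e.2).IsAcyclic := hT.sup_edge_of_not_reachable hr
      calc _ ≤ |connectedSum v T L| + |Real.exp (-v e) - 1| *
              |connectedSum v (T ⊔ SimpleGraph.edge e.1 e.2) L| := by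
            rw [← abs_mul]; exact abs_add_le _ _
        _ ≤ Real.exp (K' T) * treeSum v T L + |Real.exp (-v e) - 1| *
              (Real.exp (K' (T ⊔ SimpleGraph.edge e.1 e.2)) *
                treeSum v (T ⊔ SimpleGraph.edge e.1 e.2) L) := by
            gcongr
            · exact ih' T hT
            · exact ih' _ hT'
        _ ≤ Real.exp (K T) * treeSum v T L + (h * Real.exp (K T)) *
                treeSum v (T ⊔ SimpleGraph.edge e.1 e.2) L := by
            rw [← mul_assoc]
            gcongr
            · exact treeSum_nonneg _ _ _
            · exact treeSum_nonneg _ _ _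
        _ = _ := by ring

end Insert

/-- The tree-graph inequality of Procacci and Yuhjtman: if the energy internal to the blocks of any
partition into components is at least `-b`, then the sum over connected graphs is at most `exp b`
times the sum over trees. -/
theorem abs_connectedSum_bot_le {α : Type*} [DecidableEq α] (v : α × α → ℝ) (L : Finset (α × α))
    {b : ℝ} (hb : ∀ T, -b ≤ internalEnergy v L T) :
    |connectedSum v ⊥ L| ≤ Real.exp b * treeSum v ⊥ L :=
  abs_connectedSum_le v L (fun _ => b) (fun T => by linarith [hb T]) antitone_const ⊥
    SimpleGraph.isAcyclic_bot

/-! ### Counting trees -/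

/-- A map `p` sending each vertex to its parent, or to `none` at the roots, describes a rooted forest
if it has no cycles; this is expressed by a rank that is smaller at the parent. -/
def IsParentMap {α : Type*} (p : α → Option α) : Prop :=
  ∃ r : α → ℕ, ∀ a b, p a = some b → r b < r a

/-- Every vertex `u` has a root `w` above it, so that `w` has rank at most that of `u`. This is said of
every rank function that decreases towards the parent except possibly at `w`, as it will be used for
the map in which `w` has received a parent. -/
theorem IsParentMap.exists_root {α : Type*} {p : α → Option α} (hp : IsParentMap p) (u : α) :
    ∃ w, p w = none ∧
      ∀ r : α → ℕ, (∀ a b, a ≠ w → p a = some b → r b < r a) → r w ≤ r u := by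
  obtain ⟨r₀, hr₀⟩ := hp
  induction hu : r₀ u using Nat.strong_induction_on generalizing u with
  | _ m ih =>
    cases h : p u with
    | none => exact ⟨u, h, fun r _ => le_rfl⟩
    | some b =>
      obtain ⟨w, hw, hwr⟩ := ih (r₀ b) (hu ▸ hr₀ u b h) b rfl
      refine ⟨w, hw, fun r hr => (hwr r hr).trans (hr u b ?_ h).le⟩
      rintro rfl
      simp [h] at hw

open Classical in
/-- The rooted forests on `α` with `k` edges, as parent maps. -/
noncomputable def rootedForests (α : Type*) [Fintype α] (k : ℕ) : Finset (α → Option α) :=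
  {p | IsParentMap p ∧ ({a | p a ≠ none} : Finset α).card = k}

open Classical in
/-- For a rooted forest with `k` edges on `n` vertices and a vertex `u`, at most `n - k - 1` roots can
be made children of `u`: the root above `u` cannot. -/
theorem card_attachable_le {α : Type*} [Fintype α] {k : ℕ} {p : α → Option α}
    (hp : p ∈ rootedForests α k) (u : α) :
    ({a | p a = none ∧ IsParentMap (Function.update p a (some u))} : Finset α).card ≤
      Fintype.card α - 1 - k := by
  simp only [rootedForests, Finset.mem_filter, Finset.mem_univ, true_and] at hp
  obtain ⟨hp, hk⟩ := hp
  obtain ⟨w, hw, hwr⟩ := hp.exists_root u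
  have hsub : ({a | p a = none ∧ IsParentMap (Function.update p a (some u))} : Finset α) ⊆
      ({a | p a = none} : Finset α).erase w := by
    intro a ha
    simp only [Finset.mem_filter, Finset.mem_univ, true_and, Finset.mem_erase] at ha ⊢
    refine ⟨?_, ha.1⟩
    rintro rfl
    obtain ⟨r, hr⟩ := ha.2
    have h1 : r u < r a := hr a u (by simp)
    have h2 : r a ≤ r u := hwr r fun x y hx hxy => hr x y (by simpa [hx] using hxy)
    omega
  have hcard : ({a | p a = none} : Finset α).card + k = Fintype.card α := by
    rw [← hk]
    exact Finset.card_filter_add_card_filter_not (s := Finset.univ) (fun a => p a = none)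
  refine (Finset.card_le_card hsub).trans ?_
  rw [Finset.card_erase_of_mem (by simpa using hw)]
  omega

/-- Each forest with `k + 1` edges arises from `k + 1` forests with one edge less, by attaching a root
to a vertex. -/
theorem card_rootedForests_succ_mul_le (α : Type*) [Fintype α] (k : ℕ) :
    (rootedForests α (k + 1)).card * (k + 1) ≤
      (rootedForests α k).card * (Fintype.card α * (Fintype.card α - 1 - k)) := by
  classical
  let A : Finset (Σ _ : α → Option α, α) :=
    (rootedForests α (k + 1)).sigma fun p => {a | p a ≠ none}
  let B : Finset (Σ _ : α → Option α, Σ _ : α, α) := (rootedForests α k).sigma fun p =>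
    Finset.univ.sigma fun u => {a | p a = none ∧ IsParentMap (Function.update p a (some u))}
  have hA : A.card = (rootedForests α (k + 1)).card * (k + 1) := by
    rw [Finset.card_sigma, Finset.sum_const_nat]
    intro p hp
    simp only [rootedForests, Finset.mem_filter, Finset.mem_univ, true_and] at hp
    exact hp.2
  have hB : B.card ≤
      (rootedForests α k).card * (Fintype.card α * (Fintype.card α - 1 - k)) := by
    rw [Finset.card_sigma]
    refine Finset.sum_le_card_nsmul _ _ _ fun p hp => ?_
    rw [Finset.card_sigma]
    exact Finset.sum_le_card_nsmul _ _ _ fun u _ => card_attachable_le hp u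
  have hAB : A ⊆ B.image fun q =>
      ⟨Function.update q.1 q.2.2 (some q.2.1), q.2.2⟩ := by
    rintro ⟨p, a⟩ hpa
    simp only [A, rootedForests, Finset.mem_sigma, Finset.mem_filter, Finset.mem_univ,
      true_and] at hpa
    obtain ⟨⟨⟨r, hr⟩, hk⟩, ha⟩ := hpa
    obtain ⟨u, hu⟩ := Option.ne_none_iff_exists'.1 ha
    have hback : Function.update (Function.update p a none) a (some u) = p := by
      rw [Function.update_idem, ← hu, Function.update_eq_self]
    refine Finset.mem_image.2 ⟨⟨Function.update p a none, u, a⟩, ?_, by simp [hback]⟩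
    simp only [B, rootedForests, Finset.mem_sigma, Finset.mem_filter, Finset.mem_univ,
      true_and, Function.update_self, hback]
    refine ⟨⟨⟨r, fun x y hxy => hr x y ?_⟩, ?_⟩, ⟨r, hr⟩⟩
    · by_cases hx : x = a
      · simp [hx] at hxy
      · simpa [hx] using hxy
    · have : ({x | Function.update p a none x ≠ none} : Finset α) =
          ({x | p x ≠ none} : Finset α).erase a := by
        ext x
        by_cases hx : x = a <;> simp [hx]
      rw [this, Finset.card_erase_of_mem (by simpa using ha), hk, Nat.add_sub_cancel]
  rw [← hA]
  exact (Finset.card_le_card hAB).trans (Finset.card_image_le.trans hB)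

theorem card_rootedForests_le (α : Type*) [Fintype α] (k : ℕ) :
    (rootedForests α k).card ≤ Fintype.card α ^ k * (Fintype.card α - 1).choose k := by
  classical
  induction k with
  | zero =>
    rw [pow_zero, Nat.choose_zero_right, mul_one, Finset.card_le_one]
    intro p hp q hq
    simp only [rootedForests, Finset.mem_filter, Finset.mem_univ, true_and,
      Finset.card_eq_zero, Finset.filter_eq_empty_iff, not_not] at hp hq
    funext a
    rw [hp.2 trivial, hq.2 trivial]
  | succ k ih =>
    refine Nat.le_of_mul_le_mul_right (c := k + 1) ?_ k.succ_pos
    calc (rootedForests α (k + 1)).card * (k + 1)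
        ≤ (rootedForests α k).card * (Fintype.card α * (Fintype.card α - 1 - k)) :=
          card_rootedForests_succ_mul_le α k
      _ ≤ (Fintype.card α ^ k * (Fintype.card α - 1).choose k) *
            (Fintype.card α * (Fintype.card α - 1 - k)) := Nat.mul_le_mul_right _ ih
      _ = Fintype.card α ^ (k + 1) *
            ((Fintype.card α - 1).choose k * (Fintype.card α - 1 - k)) := by ring
      _ = _ := by rw [← Nat.choose_succ_right_eq]; ring

/-- A tree with a chosen root is the graph of a parent map: the parent of a vertex is a neighbour
that is closer to the root. -/
theorem SimpleGraph.IsTree.exists_parentMap {α : Type*} [Fintype α] {G : SimpleGraph α}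
    (hG : G.IsTree) (c : α) :
    ∃ p : α → Option α, IsParentMap p ∧ (∀ a, p a = none ↔ a = c) ∧
      ∀ a b, G.Adj a b ↔ p a = some b ∨ p b = some a := by
  classical
  have hstep : ∀ a, a ≠ c → ∃ b, G.Adj a b ∧ G.dist b c < G.dist a c := by
    intro a ha
    obtain ⟨w, hw⟩ := hG.1.exists_walk_length_eq_dist a c
    cases w with
    | nil => exact absurd rfl ha
    | @cons _ b _ hab w' =>
      refine ⟨b, hab, lt_of_le_of_lt (SimpleGraph.dist_le w') ?_⟩
      rw [← hw, SimpleGraph.Walk.length_cons]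
      exact Nat.lt_succ_self _
  choose! f hadj hdist using hstep
  let p : α → Option α := fun a => if a = c then none else some (f a)
  have hp : ∀ {a b}, p a = some b → a ≠ c ∧ f a = b := by
    intro a b h
    by_cases ha : a = c
    · simp [p, ha] at h
    · exact ⟨ha, by simpa [p, ha] using h⟩
  -- The `n - 1` edges from a vertex to its parent are distinct, so they are all the edges.
  have himg : (Finset.univ.erase c).image (fun a => s(a, f a)) = G.edgeFinset := by
    refine Finset.eq_of_subset_of_card_le ?_ ?_
    · intro e he
      obtain ⟨a, ha, rfl⟩ := Finset.mem_image.1 he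
      simpa using hadj a (Finset.ne_of_mem_erase ha)
    · have hcard := hG.card_edgeFinset
      rw [Finset.card_image_of_injOn, Finset.card_erase_of_mem (Finset.mem_univ c),
        Finset.card_univ]
      · omega
      · intro a ha b hb hab
        have ha' := hdist a (Finset.ne_of_mem_erase ha)
        have hb' := hdist b (Finset.ne_of_mem_erase hb)
        rcases Sym2.eq_iff.1 hab with ⟨h, -⟩ | ⟨h1, h2⟩
        · exact h
        · rw [h2] at ha'
          rw [← h1] at hb'
          omega
  refine ⟨p, ⟨fun a => G.dist a c, fun a b h => ?_⟩, fun a => ?_, fun a b => ⟨fun h => ?_, ?_⟩⟩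
  · obtain ⟨ha, rfl⟩ := hp h
    exact hdist a ha
  · by_cases ha : a = c <;> simp [p, ha]
  · have hmem : s(a, b) ∈ (Finset.univ.erase c).image (fun a => s(a, f a)) := by
      rw [himg]; simpa using h
    obtain ⟨x, hx, hxe⟩ := Finset.mem_image.1 hmem
    have hxc := Finset.ne_of_mem_erase hx
    rcases Sym2.eq_iff.1 hxe with ⟨rfl, h2⟩ | ⟨rfl, h2⟩
    · left; simp [p, hxc, h2]
    · right; simp [p, hxc, h2]
  · rintro (h | h)
    · obtain ⟨ha, rfl⟩ := hp h
      exact hadj a ha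
    · obtain ⟨hb, rfl⟩ := hp h
      exact (hadj b hb).symm

/-- The upper bound in Cayley's formula for the number of trees on a vertex set, here for any
finite family of trees. -/
theorem card_trees_mul_card_le {α : Type*} [Fintype α] (S : Finset (SimpleGraph α))
    (hS : ∀ G ∈ S, G.IsTree) :
    S.card * Fintype.card α ≤ Fintype.card α ^ (Fintype.card α - 1) := by
  classical
  have hex : ∀ q : SimpleGraph α × α, ∃ p : α → Option α, q.1 ∈ S →
      IsParentMap p ∧ (∀ a, p a = none ↔ a = q.2) ∧
        ∀ a b, q.1.Adj a b ↔ p a = some b ∨ p b = some a := by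
    intro q
    by_cases hq : q.1 ∈ S
    · obtain ⟨p, hp⟩ := (hS _ hq).exists_parentMap q.2
      exact ⟨p, fun _ => hp⟩
    · exact ⟨fun _ => none, fun h => absurd h hq⟩
  choose P hP using hex
  have hle : (S ×ˢ (Finset.univ : Finset α)).card ≤
      (rootedForests α (Fintype.card α - 1)).card := by
    refine Finset.card_le_card_of_injOn P ?_ ?_
    · intro q hq
      obtain ⟨h1, h2, -⟩ := hP q (Finset.mem_product.1 hq).1
      simp only [rootedForests, Finset.coe_filter, Finset.mem_univ, true_and, Set.mem_ofPred_eq]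
      refine ⟨h1, ?_⟩
      have : ({a | P q a ≠ none} : Finset α) = Finset.univ.erase q.2 := by
        ext a; simp [h2]
      rw [this, Finset.card_erase_of_mem (Finset.mem_univ _), Finset.card_univ]
    · intro q hq q' hq' h
      obtain ⟨-, h2, h3⟩ := hP q (Finset.mem_product.1 hq).1
      obtain ⟨-, h2', h3'⟩ := hP q' (Finset.mem_product.1 hq').1
      refine Prod.ext ?_ ?_
      · ext a b
        rw [h3, h3', h]
      · rw [← h2', ← h, h2]
  rw [Finset.card_product, Finset.card_univ] at hle
  refine hle.trans ((card_rootedForests_le α _).trans ?_)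
  rw [Nat.choose_self, mul_one]

/-! ### Integrating over a rooted forest -/

/-- A product integral may be compared after integrating over one variable only. -/
theorem lintegral_pi_le_of_update {α E : Type*} [Fintype α] [DecidableEq α] [Nonempty E]
    [MeasurableSpace E] (ν : Measure E) [SigmaFinite ν] {f g : (α → E) → ENNReal}
    (hf : Measurable f) (hg : Measurable g) (a : α)
    (h : ∀ x, ∫⁻ y, f (Function.update x a y) ∂ν ≤ ∫⁻ y, g (Function.update x a y) ∂ν) :
    ∫⁻ x, f x ∂Measure.pi (fun _ => ν) ≤ ∫⁻ x, g x ∂Measure.pi (fun _ => ν) := by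
  obtain ⟨e⟩ := ‹Nonempty E›
  rw [lintegral_eq_lmarginal_univ (fun _ => e), lintegral_eq_lmarginal_univ (fun _ => e),
    lmarginal_erase' f hf (Finset.mem_univ a), lmarginal_erase' g hg (Finset.mem_univ a)]
  exact lmarginal_mono h _

/-- The factor of the vertex `a` in the product over the edges of the forest `p`: the kernel on the
edge from `a` to its parent, or `1` if `a` is a root. -/
def parentFactor {α E : Type*} (k : E → E → ENNReal) (p : α → Option α) (x : α → E) (a : α) :
    ENNReal :=
  (p a).elim 1 fun b => k (x a) (x b)

theorem measurable_parentFactor {α E : Type*} [MeasurableSpace E] {k : E → E → ENNReal}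
    (hk : Measurable fun q : E × E => k q.1 q.2) (p : α → Option α) (a : α) :
    Measurable fun x : α → E => parentFactor k p x a := by
  unfold parentFactor
  cases p a with
  | none => exact measurable_const
  | some b =>
    have hab : Measurable fun x : α → E => (x a, x b) :=
      (measurable_pi_apply a).prodMk (measurable_pi_apply b)
    exact hk.comp hab

open Classical in
/-- The integral of a product over the edges of a rooted forest: each edge contributes `C` and each
root the total mass. The mass is multiplied out, so that vertices outside `S` do not matter. The
variables are integrated out in order of decreasing rank. -/
theorem pow_mul_lintegral_prod_parentFactor_le {α E : Type*} [Fintype α] [Nonempty E]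
    [MeasurableSpace E] (ν : Measure E) [SigmaFinite ν] {k : E → E → ENNReal}
    (hk : Measurable fun q : E × E => k q.1 q.2) {C : ENNReal}
    (hC : ∀ x, ∫⁻ y, k y x ∂ν ≤ C) {p : α → Option α} (hp : IsParentMap p) (S : Finset α) :
    ν Set.univ ^ (S.filter fun a => p a ≠ none).card *
        ∫⁻ x, ∏ a ∈ S, parentFactor k p x a ∂Measure.pi (fun _ => ν) ≤
      C ^ (S.filter fun a => p a ≠ none).card * ν Set.univ ^ Fintype.card α := by
  obtain ⟨r, hr⟩ := hp
  refine Finset.induction_on_max_value r S ?_ ?_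
  · simp [Measure.pi_univ]
  · intro a S ha hmax ih
    cases hpa : p a with
    | none =>
      have h1 : ∀ x, ∏ a ∈ insert a S, parentFactor k p x a = ∏ a ∈ S, parentFactor k p x a := by
        intro x
        rw [Finset.prod_insert ha]
        simp [parentFactor, hpa]
      simp_rw [h1]
      rw [Finset.filter_insert, if_neg (by simp [hpa])]
      exact ih
    | some b =>
      have hba : b ≠ a := by
        rintro rfl
        exact lt_irrefl _ (hr b b hpa)
      have hmeas : Measurable fun x : α → E => ∏ a ∈ S, parentFactor k p x a :=
        Finset.measurable_fun_prod _ fun c _ => measurable_parentFactor hk p c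
      have hupd : ∀ (x : α → E) y, ∏ c ∈ S, parentFactor k p (Function.update x a y) c =
          ∏ c ∈ S, parentFactor k p x c := by
        intro x y
        refine Finset.prod_congr rfl fun c hc => ?_
        have hca : c ≠ a := fun h => ha (h ▸ hc)
        unfold parentFactor
        cases hpc : p c with
        | none => rfl
        | some d =>
          have hda : d ≠ a := by
            rintro rfl
            exact absurd (hr c d hpc) (not_lt.2 (hmax c hc))
          simp [hca, hda]
      have hstep : ν Set.univ *
            ∫⁻ x, ∏ c ∈ insert a S, parentFactor k p x c ∂Measure.pi (fun _ => ν) ≤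
          C * ∫⁻ x, ∏ c ∈ S, parentFactor k p x c ∂Measure.pi (fun _ => ν) := by
        have hmeas' : Measurable fun x : α → E => ∏ c ∈ insert a S, parentFactor k p x c :=
          Finset.measurable_fun_prod _ fun c _ => measurable_parentFactor hk p c
        rw [← lintegral_const_mul _ hmeas', ← lintegral_const_mul _ hmeas]
        refine lintegral_pi_le_of_update ν (hmeas'.const_mul _) (hmeas.const_mul _) a fun x => ?_
        have h2 : ∀ y, ∏ c ∈ insert a S, parentFactor k p (Function.update x a y) c =
            k y (x b) * ∏ c ∈ S, parentFactor k p x c := by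
          intro y
          rw [Finset.prod_insert ha, hupd]
          simp [parentFactor, hpa, hba]
        have hky : Measurable fun y => k y (x b) :=
          hk.comp (f := fun y => (y, x b)) (measurable_id.prodMk measurable_const)
        simp_rw [h2, hupd]
        rw [lintegral_const_mul _ (hky.mul_const _), lintegral_mul_const _ hky, lintegral_const,
          mul_comm (ν Set.univ)]
        gcongr
        exact hC _
      rw [Finset.filter_insert, if_pos (by simp [hpa]),
        Finset.card_insert_of_notMem (by simp [ha]), pow_succ, pow_succ, mul_assoc]
      calc _ ≤ ν Set.univ ^ (S.filter fun a => p a ≠ none).card *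
              (C * ∫⁻ x, ∏ c ∈ S, parentFactor k p x c ∂Measure.pi (fun _ => ν)) := by gcongr
        _ = C * (ν Set.univ ^ (S.filter fun a => p a ≠ none).card *
              ∫⁻ x, ∏ c ∈ S, parentFactor k p x c ∂Measure.pi (fun _ => ν)) := by ring
        _ ≤ C * (C ^ (S.filter fun a => p a ≠ none).card * ν Set.univ ^ Fintype.card α) := by
            gcongr
        _ = _ := by ring

/-! ### Stability of the Lennard-Jones potential -/

theorem lennardJones_eq (r : ℝ) : lennardJones r = (1 / r ^ 6) ^ 2 - 2 * (1 / r ^ 6) := by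
  unfold lennardJones
  ring

theorem neg_one_le_lennardJones (r : ℝ) : -1 ≤ lennardJones r := by
  rw [lennardJones_eq]
  nlinarith [sq_nonneg (1 / r ^ 6 - 1)]

theorem integrable_one_div_one_add_norm_pow_six :
    Integrable fun z : Space => 1 / (1 + ‖z‖) ^ 6 := by
  have h : Integrable fun z : Space => (1 + ‖z‖) ^ (-(6 : ℝ)) :=
    integrable_one_add_norm (by simp; norm_num)
  refine h.congr (Filter.Eventually.of_forall fun z => ?_)
  simp only
  rw [Real.rpow_neg (by positivity), one_div]
  norm_cast

/-- Around a point at distance at least `r` from all the others, `r`-separated points attract with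
total strength at most of order `r ^ (-6)`: the balls of radius `r / 2` are disjoint, so that the sum
is dominated by an integral. -/
theorem exists_sum_inv_norm_pow_le : ∃ c : ℝ, 0 ≤ c ∧ ∀ (ι : Type) (S : Finset ι) (y : ι → Space)
    (r : ℝ), 0 < r → (∀ i ∈ S, r ≤ ‖y i‖) →
    (∀ i ∈ S, ∀ j ∈ S, i ≠ j → r ≤ ‖y i - y j‖) →
    ∑ i ∈ S, 1 / ‖y i‖ ^ 6 ≤ c * (1 / r ^ 6) := by
  let g : Space → ℝ := fun z => 1 / (1 + ‖z‖) ^ 6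
  have hg : Integrable g := integrable_one_div_one_add_norm_pow_six
  have hg0 : ∀ z, 0 ≤ g z := fun z => by positivity
  let w : ℝ := volume.real (Metric.ball (0 : Space) (1 / 2))
  have hw : 0 < w := by
    refine ENNReal.toReal_pos (Metric.measure_ball_pos _ _ (by norm_num)).ne' ?_
    exact measure_ball_lt_top.ne
  have hball : ∀ z : Space, volume.real (Metric.ball z (1 / 2)) = w := by
    intro z
    simp only [w, Measure.real]
    rw [Measure.addHaar_ball_center]
  refine ⟨(5 / 2) ^ 6 * (∫ z, g z) / w, by positivity, fun ι S y r hr hy hsep => ?_⟩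
  have hrs : ∀ z : Space, ‖r⁻¹ • z‖ = r⁻¹ * ‖z‖ := fun z => by
    rw [norm_smul, Real.norm_of_nonneg (by positivity)]
  have hdisj : Set.PairwiseDisjoint (S : Set ι) fun i => Metric.ball (r⁻¹ • y i) (1 / 2) := by
    intro i hi j hj hij
    refine Metric.ball_disjoint_ball ?_
    rw [dist_eq_norm, ← smul_sub, hrs]
    have := hsep i hi j hj hij
    rw [inv_mul_eq_div, le_div_iff₀ hr]
    linarith
  have hterm : ∀ i ∈ S, w * (1 / ‖y i‖ ^ 6) ≤
      (1 / r ^ 6) * ((5 / 2) ^ 6 * ∫ z in Metric.ball (r⁻¹ • y i) (1 / 2), g z) := by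
    intro i hi
    have hyi : 0 < ‖y i‖ := hr.trans_le (hy i hi)
    set t := ‖r⁻¹ • y i‖ with ht
    have ht' : t = r⁻¹ * ‖y i‖ := hrs _
    have ht1 : 1 ≤ t := by
      rw [ht', inv_mul_eq_div, le_div_iff₀ hr]
      linarith [hy i hi]
    have hlow : ∀ z ∈ Metric.ball (r⁻¹ • y i) (1 / 2 : ℝ), 1 / (5 / 2 * t) ^ 6 ≤ g z := by
      intro z hz
      have h1 : ‖z‖ ≤ t + 1 / 2 := by
        have := norm_sub_norm_le z (r⁻¹ • y i)
        rw [Metric.mem_ball, dist_eq_norm] at hz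
        linarith
      simp only [g]
      gcongr
      linarith
    have hint : w * (1 / (5 / 2 * t) ^ 6) ≤
        ∫ z in Metric.ball (r⁻¹ • y i) (1 / 2), g z := by
      have := setIntegral_mono_on (μ := volume) (s := Metric.ball (r⁻¹ • y i) (1 / 2))
        (integrableOn_const (measure_ball_lt_top.ne)) hg.integrableOn
        Metric.isOpen_ball.measurableSet hlow
      rwa [setIntegral_const, smul_eq_mul, hball] at this
    calc w * (1 / ‖y i‖ ^ 6) =
          (1 / r ^ 6) * ((5 / 2) ^ 6 * (w * (1 / (5 / 2 * t) ^ 6))) := by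
          rw [ht']; field_simp
      _ ≤ _ := by gcongr
  have hsum : ∑ i ∈ S, ∫ z in Metric.ball (r⁻¹ • y i) (1 / 2), g z ≤ ∫ z, g z := by
    rw [← integral_biUnion_finset S (fun i _ => Metric.isOpen_ball.measurableSet) hdisj
      (fun i _ => hg.integrableOn)]
    exact setIntegral_le_integral hg (Filter.Eventually.of_forall hg0)
  have hmul : w * ∑ i ∈ S, 1 / ‖y i‖ ^ 6 ≤ (1 / r ^ 6) * ((5 / 2) ^ 6 * ∫ z, g z) := by
    calc w * ∑ i ∈ S, 1 / ‖y i‖ ^ 6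
        ≤ ∑ i ∈ S, (1 / r ^ 6) * ((5 / 2) ^ 6 *
            ∫ z in Metric.ball (r⁻¹ • y i) (1 / 2), g z) := by
          rw [Finset.mul_sum]
          exact Finset.sum_le_sum hterm
      _ = (1 / r ^ 6) * ((5 / 2) ^ 6 *
            ∑ i ∈ S, ∫ z in Metric.ball (r⁻¹ • y i) (1 / 2), g z) := by
          rw [Finset.mul_sum, Finset.mul_sum]
      _ ≤ _ := by gcongr
  rw [div_mul_eq_mul_div, le_div_iff₀ hw]
  linarith

/-- The energy of the particles with labels in `S`. -/
noncomputable def subsetEnergy (V : ℝ → ℝ) {α : Type*} [LinearOrder α] (x : α → Space)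
    (S : Finset α) : ℝ :=
  ∑ p ∈ (S ×ˢ S).filter fun p => p.1 < p.2, V ‖x p.1 - x p.2‖

theorem subsetEnergy_insert (V : ℝ → ℝ) {α : Type*} [LinearOrder α] (x : α → Space)
    {S : Finset α} {a : α} (ha : a ∉ S) :
    subsetEnergy V x (insert a S) = subsetEnergy V x S + ∑ b ∈ S, V ‖x a - x b‖ := by
  have hpair : ∀ U : Finset α, subsetEnergy V x U =
      ∑ i ∈ U, ∑ j ∈ U, if i < j then V ‖x i - x j‖ else 0 := by
    intro U
    rw [subsetEnergy, Finset.sum_filter, Finset.sum_product]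
  rw [hpair, hpair, Finset.sum_insert ha, Finset.sum_insert ha, if_neg (lt_irrefl a), zero_add]
  simp_rw [Finset.sum_insert ha, Finset.sum_add_distrib]
  have : ∑ b ∈ S, V ‖x a - x b‖ = (∑ j ∈ S, if a < j then V ‖x a - x j‖ else 0) +
      ∑ i ∈ S, if i < a then V ‖x i - x a‖ else 0 := by
    rw [← Finset.sum_add_distrib]
    refine Finset.sum_congr rfl fun b hb => ?_
    have hne : a ≠ b := fun h => ha (h ▸ hb)
    rcases lt_or_gt_of_ne hne with h | h
    · simp [h, h.not_gt]
    · simp [h, h.not_gt, norm_sub_rev (x a)]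
  rw [this]
  ring

theorem configEnergy_eq_subsetEnergy (V : ℝ → ℝ) {N : ℕ} (x : Fin N → Space) :
    configEnergy V x = subsetEnergy V x Finset.univ := by
  rw [configEnergy, subsetEnergy, Finset.univ_product_univ]

theorem subsetEnergy_map (V : ℝ → ℝ) {α γ : Type*} [LinearOrder α] [LinearOrder γ]
    (f : γ ↪o α) (x : α → Space) (S : Finset γ) :
    subsetEnergy V x (S.map f.toEmbedding) = subsetEnergy V (x ∘ f) S := by
  induction S using Finset.induction_on with
  | empty => simp [subsetEnergy]
  | insert a S ha ih =>
    rw [Finset.map_insert, subsetEnergy_insert _ _ (by simpa using ha),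
      subsetEnergy_insert _ _ ha, ih, Finset.sum_map]
    rfl

/-- Stability of the Lennard-Jones potential: a particle that realizes the minimal distance `r` has
energy at least `r ^ (-12) - 2 c r ^ (-6) ≥ -c ^ 2`; remove it and induct. -/
theorem ljStabilityBounds_nonempty : ljStabilityBounds.Nonempty := by
  obtain ⟨c, hc, hsum⟩ := exists_sum_inv_norm_pow_le
  refine ⟨c ^ 2, fun N x hx => ?_⟩
  rw [configEnergy_eq_subsetEnergy]
  have main : ∀ (m : ℕ) (S : Finset (Fin N)), S.card = m →
      -(c ^ 2 * m) ≤ subsetEnergy lennardJones x S := by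
    intro m
    induction m with
    | zero =>
      intro S hS
      rw [Finset.card_eq_zero] at hS
      simp [hS, subsetEnergy]
    | succ m ih =>
      intro S hS
      rcases Nat.eq_zero_or_pos m with rfl | hm
      · obtain ⟨a, rfl⟩ := Finset.card_eq_one.1 (by simpa using hS)
        have : subsetEnergy lennardJones x {a} = 0 := by
          simp [subsetEnergy, Finset.filter_singleton]
        rw [this]
        nlinarith [sq_nonneg c]
      · have hne : S.offDiag.Nonempty := by
          obtain ⟨i, hi, j, hj, hij⟩ := Finset.one_lt_card.1 (show 1 < S.card by omega)
          exact ⟨(i, j), Finset.mem_offDiag.2 ⟨hi, hj, hij⟩⟩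
        obtain ⟨⟨a, b⟩, hab, hmin⟩ :=
          Finset.exists_min_image S.offDiag (fun q => ‖x q.1 - x q.2‖) hne
        obtain ⟨ha, hb, hne'⟩ := Finset.mem_offDiag.1 hab
        have hmin' : ∀ i ∈ S, ∀ j ∈ S, i ≠ j → ‖x a - x b‖ ≤ ‖x i - x j‖ := fun i hi j hj hij =>
          hmin (i, j) (Finset.mem_offDiag.2 ⟨hi, hj, hij⟩)
        set r := ‖x a - x b‖ with hr
        have hr0 : 0 < r := norm_pos_iff.2 (sub_ne_zero.2 fun h => hne' (hx h))
        have hS' : ∀ i ∈ S.erase a, i ∈ S ∧ a ≠ i := fun i hi =>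
          ⟨Finset.mem_of_mem_erase hi, (Finset.ne_of_mem_erase hi).symm⟩
        have hattr := hsum (Fin N) (S.erase a) (fun i => x a - x i) r hr0
          (fun i hi => hmin' a ha i (hS' i hi).1 (hS' i hi).2)
          (fun i hi j hj hij => by
            rw [sub_sub_sub_cancel_left]
            exact hmin' j (hS' j hj).1 i (hS' i hi).1 hij.symm)
        have hb' : b ∈ S.erase a := Finset.mem_erase.2 ⟨hne'.symm, hb⟩
        have hrep : (1 / r ^ 6) ^ 2 ≤ ∑ i ∈ S.erase a, (1 / ‖x a - x i‖ ^ 6) ^ 2 :=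
          Finset.single_le_sum (f := fun i => (1 / ‖x a - x i‖ ^ 6) ^ 2)
            (fun i _ => sq_nonneg _) hb'
        have henergy : -c ^ 2 ≤ ∑ i ∈ S.erase a, lennardJones ‖x a - x i‖ := by
          simp_rw [lennardJones_eq]
          rw [Finset.sum_sub_distrib, ← Finset.mul_sum]
          nlinarith [sq_nonneg (1 / r ^ 6 - c)]
        have hcard : (S.erase a).card = m := by
          rw [Finset.card_erase_of_mem ha, hS, Nat.add_sub_cancel]
        rw [← Finset.insert_erase ha, subsetEnergy_insert _ _ (Finset.notMem_erase a S)]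
        have := ih _ hcard
        push_cast
        linarith
  simpa using main N Finset.univ (by simp)

/-- The infimum is attained: the conditions on `B` are closed, and one particle forces `0 ≤ B`. -/
theorem isLeast_ljStabilityConst : IsLeast ljStabilityBounds ljStabilityConst := by
  have hbdd : BddBelow ljStabilityBounds := by
    refine ⟨0, fun B hB => ?_⟩
    have := hB 1 (fun _ => 0) (Function.injective_of_subsingleton _)
    have h0 : configEnergy lennardJones (fun _ : Fin 1 => (0 : Space)) = 0 := by
      simp [configEnergy, lennardJones]
    rw [h0] at this
    simpa using this
  refine ⟨fun N x hx => ?_, fun B hB => csInf_le hbdd hB⟩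
  rcases Nat.eq_zero_or_pos N with rfl | hN
  · simp [configEnergy]
  · have hN' : (0 : ℝ) < N := Nat.cast_pos.2 hN
    have : -configEnergy lennardJones x / N ≤ ljStabilityConst := by
      refine le_csInf ljStabilityBounds_nonempty fun B hB => ?_
      rw [div_le_iff₀ hN']
      linarith [hB N x hx]
    rw [div_le_iff₀ hN'] at this
    linarith

/-- Stability for the particles with labels in a subset. -/
theorem neg_mul_card_le_subsetEnergy {α : Type*} [LinearOrder α] {x : α → Space}
    (hx : Function.Injective x) (S : Finset α) :
    -(ljStabilityConst * S.card) ≤ subsetEnergy lennardJones x S := by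
  have h := isLeast_ljStabilityConst.1 S.card (x ∘ S.orderEmbOfFin rfl)
    (hx.comp (S.orderEmbOfFin rfl).injective)
  rw [configEnergy_eq_subsetEnergy, ← subsetEnergy_map] at h
  have hS : Finset.univ.map (S.orderEmbOfFin rfl).toEmbedding = S := by
    ext a
    simp only [Finset.mem_map, Finset.mem_univ, true_and, RelEmbedding.coe_toEmbedding]
    rw [← Set.mem_range, Finset.range_orderEmbOfFin, Finset.mem_coe]
  rwa [hS] at h

/-! ### The Mayer integrand -/

/-- The pairs of labels, each written in increasing order. -/
def orderedPairs (n : ℕ) : Finset (Fin n × Fin n) := Finset.univ.filter fun p => p.1 < p.2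

theorem mem_orderedPairs {n : ℕ} {p : Fin n × Fin n} : p ∈ orderedPairs n ↔ p.1 < p.2 := by
  simp [orderedPairs]

theorem pairGraph_adj_of_lt {n : ℕ} {F : Finset (Fin n × Fin n)} (hF : F ⊆ orderedPairs n)
    {a b : Fin n} (hab : a < b) : (pairGraph F).Adj a b ↔ (a, b) ∈ F := by
  rw [pairGraph_adj]
  constructor
  · rintro ⟨-, h | h⟩
    · exact h
    · exact absurd (mem_orderedPairs.1 (hF h)) hab.not_gt
  · exact fun h => ⟨hab.ne, Or.inl h⟩

theorem pairGraph_injOn (n : ℕ) :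
    Set.InjOn pairGraph {F : Finset (Fin n × Fin n) | F ⊆ orderedPairs n} := by
  intro F hF F' hF' h
  ext ⟨a, b⟩
  by_cases hab : a < b
  · rw [← pairGraph_adj_of_lt hF hab, ← pairGraph_adj_of_lt hF' hab, h]
  · exact ⟨fun h => absurd (mem_orderedPairs.1 (hF h)) hab,
      fun h => absurd (mem_orderedPairs.1 (hF' h)) hab⟩

theorem mayerIntegrand_eq_connectedSum (V : ℝ → ℝ) (β : ℝ) (n : ℕ) (x : Fin n → Space) :
    mayerIntegrand V β n x =
      connectedSum (fun p => β * V ‖x p.1 - x p.2‖) ⊥ (orderedPairs n) := by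
  classical
  rw [mayerIntegrand, connectedSum_eq_sum_filter]
  have hsub : ∀ g : SimpleGraph (Fin n),
      (Finset.univ.filter fun p : Fin n × Fin n => p.1 < p.2 ∧ g.Adj p.1 p.2) ⊆
        orderedPairs n := fun g p hp => by
    simp only [Finset.mem_filter, Finset.mem_univ, true_and] at hp
    exact mem_orderedPairs.2 hp.1
  have hgraph : ∀ g : SimpleGraph (Fin n),
      pairGraph (Finset.univ.filter fun p : Fin n × Fin n => p.1 < p.2 ∧ g.Adj p.1 p.2) = g := by
    intro g
    ext a b
    rcases lt_trichotomy a b with h | rfl | h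
    · rw [pairGraph_adj_of_lt (hsub g) h]; simp [h]
    · simp
    · rw [SimpleGraph.adj_comm, pairGraph_adj_of_lt (hsub g) h, g.adj_comm]; simp [h]
  refine Finset.sum_bij
    (fun g _ => Finset.univ.filter fun p : Fin n × Fin n => p.1 < p.2 ∧ g.Adj p.1 p.2) ?_ ?_ ?_ ?_
  · intro g hg
    simp only [Finset.mem_filter, Finset.mem_powerset, bot_sup_eq, hgraph]
    exact ⟨hsub g, (Finset.mem_filter.1 hg).2⟩
  · intro g _ g' _ h
    rw [← hgraph g, h, hgraph]
  · intro F hF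
    simp only [Finset.mem_filter, Finset.mem_powerset, bot_sup_eq] at hF
    refine ⟨pairGraph F, by simpa using hF.2, ?_⟩
    exact pairGraph_injOn n (hsub _) hF.1 (hgraph _)
  · intro g _
    refine Finset.prod_congr (by ext; simp) fun p _ => ?_
    rw [neg_mul]

/-- Stability bounds the energy internal to the components of a graph, component by component. -/
theorem neg_le_internalEnergy {β : ℝ} (hβ : 0 ≤ β) {n : ℕ} {x : Fin n → Space}
    (hx : Function.Injective x) (T : SimpleGraph (Fin n)) :
    -(β * ljStabilityConst * n) ≤
      internalEnergy (fun p => β * lennardJones ‖x p.1 - x p.2‖) (orderedPairs n) T := by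
  classical
  let c : Fin n → T.ConnectedComponent := T.connectedComponentMk
  have hfib : ∀ k : T.ConnectedComponent,
      ∑ e ∈ ((orderedPairs n).filter fun e => T.Reachable e.1 e.2) with c e.1 = k,
        lennardJones ‖x e.1 - x e.2‖ =
      subsetEnergy lennardJones x (Finset.univ.filter fun a => c a = k) := by
    intro k
    unfold subsetEnergy
    refine Finset.sum_congr ?_ fun _ _ => rfl
    ext ⟨a, b⟩
    simp only [Finset.mem_filter, mem_orderedPairs, Finset.mem_product, Finset.mem_univ, true_and,
      c, ← SimpleGraph.ConnectedComponent.eq]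
    constructor
    · rintro ⟨⟨h1, h2⟩, rfl⟩
      exact ⟨⟨rfl, h2.symm⟩, h1⟩
    · rintro ⟨⟨h1, h2⟩, h3⟩
      exact ⟨⟨h3, h1.trans h2.symm⟩, h1⟩
  have hsum : internalEnergy (fun p => β * lennardJones ‖x p.1 - x p.2‖) (orderedPairs n) T =
      β * ∑ k, subsetEnergy lennardJones x (Finset.univ.filter fun a => c a = k) := by
    rw [internalEnergy_eq_sum_filter, ← Finset.mul_sum]
    congr 1
    rw [← Finset.sum_fiberwise _ (fun e : Fin n × Fin n => c e.1)]
    refine Finset.sum_congr rfl fun k _ => ?_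
    convert hfib k
  have hcard : (n : ℝ) = ∑ k, ((Finset.univ.filter fun a => c a = k).card : ℝ) := by
    rw [← Nat.cast_sum, ← Finset.card_eq_sum_card_fiberwise (f := c) (s := Finset.univ)
      (fun _ _ => Finset.mem_coe.2 (Finset.mem_univ _)), Finset.card_univ, Fintype.card_fin]
  rw [hsum, hcard, mul_assoc, ← mul_neg, Finset.mul_sum, ← Finset.sum_neg_distrib]
  gcongr
  exact neg_mul_card_le_subsetEnergy hx _

theorem abs_mayerIntegrand_le {β : ℝ} (hβ : 0 ≤ β) {n : ℕ} {x : Fin n → Space}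
    (hx : Function.Injective x) :
    |mayerIntegrand lennardJones β n x| ≤ Real.exp (β * ljStabilityConst * n) *
      treeSum (fun p => β * lennardJones ‖x p.1 - x p.2‖) ⊥ (orderedPairs n) := by
  rw [mayerIntegrand_eq_connectedSum]
  exact abs_connectedSum_bot_le _ _ (neg_le_internalEnergy hβ hx)

theorem measurable_lennardJones : Measurable lennardJones := by
  unfold lennardJones
  fun_prop

theorem measurable_mayerIntegrand (β : ℝ) (n : ℕ) :
    Measurable (mayerIntegrand lennardJones β n) := by
  classical
  unfold mayerIntegrand
  refine Finset.measurable_fun_sum _ fun g _ => Finset.measurable_fun_prod _ fun p _ => ?_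
  have : Measurable fun x : Fin n → Space => lennardJones ‖x p.1 - x p.2‖ :=
    measurable_lennardJones.comp (by fun_prop)
  fun_prop

/-- The product over the edges of a tree, rewritten as a product over the vertices: the edge to the
parent is attributed to the child. -/
theorem prod_eq_prod_parentFactor {n : ℕ} {E : Type*} {k : E → E → ENNReal}
    (hk : ∀ y z, k y z = k z y) {F : Finset (Fin n × Fin n)} (hF : F ⊆ orderedPairs n)
    {p : Fin n → Option (Fin n)} (hp : IsParentMap p)
    (hadj : ∀ a b, (pairGraph F).Adj a b ↔ p a = some b ∨ p b = some a) (x : Fin n → E) :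
    ∏ e ∈ F, k (x e.1) (x e.2) = ∏ a, parentFactor k p x a := by
  classical
  obtain ⟨r, hr⟩ := hp
  have hasymm : ∀ {a b}, p a = some b → p b ≠ some a := fun h h' =>
    absurd (hr _ _ h) (hr _ _ h').not_gt
  have hmem : ∀ e ∈ F, p e.1 = some e.2 ∨ p e.2 = some e.1 := fun e he =>
    (hadj _ _).1 ((pairGraph_adj_of_lt hF (mem_orderedPairs.1 (hF he))).2 he)
  have hrhs : ∏ a, parentFactor k p x a =
      ∏ a ∈ Finset.univ.filter (fun a => p a ≠ none), parentFactor k p x a := by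
    refine (Finset.prod_filter_of_ne ?_).symm
    intro a _ ha h
    exact ha (by simp [parentFactor, h])
  rw [hrhs]
  refine Finset.prod_nbij (fun e => if p e.1 = some e.2 then e.1 else e.2) ?_ ?_ ?_ ?_
  · intro e he
    rcases hmem e he with h | h
    · simp [h]
    · simp [h, hasymm h]
  · intro e he e' he' heq
    have hlt := mem_orderedPairs.1 (hF he)
    have hlt' := mem_orderedPairs.1 (hF he')
    obtain ⟨a, b⟩ := e
    obtain ⟨a', b'⟩ := e'
    simp only at heq hlt hlt'
    rcases hmem _ he with h | h <;> rcases hmem _ he' with h' | h' <;> simp only at h h'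
    · rw [if_pos h, if_pos h'] at heq
      subst heq
      rw [h] at h'
      simpa using h'
    · rw [if_pos h, if_neg (hasymm h')] at heq
      subst heq
      rw [h] at h'
      obtain rfl := Option.some.inj h'
      exact absurd hlt hlt'.not_gt
    · rw [if_neg (hasymm h), if_pos h'] at heq
      subst heq
      rw [h] at h'
      obtain rfl := Option.some.inj h'
      exact absurd hlt hlt'.not_gt
    · rw [if_neg (hasymm h), if_neg (hasymm h')] at heq
      subst heq
      rw [h] at h'
      simpa using h'
  · intro a ha
    obtain ⟨b, hb⟩ := Option.ne_none_iff_exists'.1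
      (Finset.mem_filter.1 (Finset.mem_coe.1 ha)).2
    have hg : (pairGraph F).Adj a b := (hadj a b).2 (Or.inl hb)
    rcases lt_or_gt_of_ne hg.ne with h | h
    · exact ⟨(a, b), (pairGraph_adj_of_lt hF h).1 hg, by simp [hb]⟩
    · exact ⟨(b, a), (pairGraph_adj_of_lt hF h).1 hg.symm, by simp [hasymm hb]⟩
  · intro e he
    rcases hmem e he with h | h
    · simp [h, parentFactor]
    · simp [h, hasymm h, parentFactor, hk (x e.1)]

/-- The integral over `Λ ^ n` of a product over the edges of a tree. -/
theorem lintegral_prod_tree_le {n : ℕ} (hn : 1 ≤ n) {E : Type*} [MeasurableSpace E] [Nonempty E]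
    (ν : Measure E) [IsFiniteMeasure ν] (hν : ν ≠ 0) {k : E → E → ENNReal}
    (hk : Measurable fun q : E × E => k q.1 q.2) (hsymm : ∀ y z, k y z = k z y) {C : ENNReal}
    (hC : ∀ x, ∫⁻ y, k y x ∂ν ≤ C) {F : Finset (Fin n × Fin n)} (hF : F ⊆ orderedPairs n)
    (htree : (pairGraph F).IsTree) :
    ∫⁻ x, ∏ e ∈ F, k (x e.1) (x e.2) ∂Measure.pi (fun _ => ν) ≤ C ^ (n - 1) * ν Set.univ := by
  classical
  obtain ⟨p, hp, hroot, hadj⟩ := htree.exists_parentMap (⟨0, hn⟩ : Fin n)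
  simp_rw [prod_eq_prod_parentFactor hsymm hF hp hadj]
  have h := pow_mul_lintegral_prod_parentFactor_le ν hk hC hp Finset.univ
  have hcard : (Finset.univ.filter fun a => p a ≠ none).card = n - 1 := by
    have : (Finset.univ.filter fun a => p a ≠ none) = Finset.univ.erase (⟨0, hn⟩ : Fin n) := by
      ext a; simp [hroot]
    rw [this, Finset.card_erase_of_mem (Finset.mem_univ _), Finset.card_univ, Fintype.card_fin]
  have hpow : ν Set.univ ^ n = ν Set.univ ^ (n - 1) * ν Set.univ := by
    rw [← pow_succ, Nat.sub_add_cancel hn]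
  rw [hcard, Fintype.card_fin, hpow, mul_left_comm] at h
  refine (ENNReal.mul_le_mul_iff_right (pow_ne_zero _ ?_) (ENNReal.pow_ne_top ?_)).1 h
  · simpa using hν
  · exact measure_ne_top _ _

/-! ### The cutoff potential and the bound on the Mayer coefficients -/

theorem abs_lennardJones_le {a r : ℝ} (ha : 0 < a) (har : a < r) :
    |lennardJones r| ≤ (1 / a ^ 6 + 2) * (1 + 1 / a) ^ 6 * (1 / (1 + r) ^ 6) := by
  have hr : 0 < r := ha.trans har
  have hu : 1 / r ^ 6 ≤ 1 / a ^ 6 := by gcongr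
  have hu0 : 0 < 1 / r ^ 6 := by positivity
  have hle : 1 / r ^ 6 ≤ (1 + 1 / a) ^ 6 * (1 / (1 + r) ^ 6) := by
    have h1 : 1 + r ≤ (1 + 1 / a) * r := by
      have : 1 ≤ 1 / a * r := by
        rw [div_mul_eq_mul_div, one_mul, le_div_iff₀ ha]
        linarith
      linarith
    rw [mul_one_div, div_le_div_iff₀ (by positivity) (by positivity), one_mul, ← mul_pow]
    gcongr
  calc |lennardJones r| ≤ (1 / a ^ 6 + 2) * (1 / r ^ 6) := by
        rw [lennardJones_eq, abs_le]
        constructor <;> nlinarith [sq_nonneg (1 / r ^ 6)]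
    _ ≤ _ := by rw [mul_assoc]; gcongr

theorem measurable_cutoffLJ (a : ℝ) : Measurable (cutoffLJ a) := by
  unfold cutoffLJ
  exact Measurable.ite measurableSet_Ioi measurable_lennardJones measurable_const

theorem measurable_ctildeIntegrand (a β : ℝ) : Measurable (ctildeIntegrand a β) := by
  have h1 : Measurable fun x : Space => lennardJones ‖x‖ :=
    measurable_lennardJones.comp measurable_norm
  have h2 : Measurable fun x : Space => cutoffLJ a ‖x‖ :=
    (measurable_cutoffLJ a).comp measurable_norm
  unfold ctildeIntegrand
  exact (((h1.sub h2).const_mul _).exp.sub_const _).abs.add (h2.abs.const_mul _)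

theorem ctildeIntegrand_nonneg {a β : ℝ} (hβ : 0 ≤ β) (x : Space) : 0 ≤ ctildeIntegrand a β x := by
  unfold ctildeIntegrand
  positivity

/-- Inside the cutoff radius the integrand is bounded, since the potential is bounded below; outside
it decays like the sixth power of the distance. -/
theorem integrable_ctildeIntegrand {a β : ℝ} (ha : 0 < a) (hβ : 0 ≤ β) :
    Integrable (ctildeIntegrand a β) := by
  let D : ℝ := Real.exp (β * (1 + |lennardJones a|)) + 1 + β * |lennardJones a|
  let D' : ℝ := β * ((1 / a ^ 6 + 2) * (1 + 1 / a) ^ 6)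
  have hD : 0 ≤ D := by positivity
  have hD' : 0 ≤ D' := by positivity
  refine (integrable_one_div_one_add_norm_pow_six.const_mul (D * (1 + a) ^ 6 + D')).mono'
    (measurable_ctildeIntegrand a β).aestronglyMeasurable
    (Filter.Eventually.of_forall fun x => ?_)
  rw [Real.norm_of_nonneg (ctildeIntegrand_nonneg hβ x), add_mul]
  unfold ctildeIntegrand cutoffLJ
  by_cases hx : a < ‖x‖
  · have h := abs_lennardJones_le ha hx
    simp only [hx, if_true, sub_self, mul_zero, Real.exp_zero, abs_zero, zero_add]
    calc β * |lennardJones ‖x‖| ≤ β * ((1 / a ^ 6 + 2) * (1 + 1 / a) ^ 6 *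
            (1 / (1 + ‖x‖) ^ 6)) := by gcongr
      _ = D' * (1 / (1 + ‖x‖) ^ 6) := by simp only [D']; ring
      _ ≤ _ := le_add_of_nonneg_left (by positivity)
  · simp only [hx, if_false]
    have h1 : |Real.exp (-β * (lennardJones ‖x‖ - lennardJones a)) - 1| ≤
        Real.exp (β * (1 + |lennardJones a|)) + 1 := by
      refine (abs_sub _ _).trans ?_
      rw [Real.abs_exp, abs_one]
      refine add_le_add (Real.exp_le_exp.2 ?_) le_rfl
      have := neg_one_le_lennardJones ‖x‖
      have := le_abs_self (lennardJones a)
      nlinarith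
    have h2 : 1 ≤ (1 + a) ^ 6 * (1 / (1 + ‖x‖) ^ 6) := by
      rw [mul_one_div, le_div_iff₀ (by positivity), one_mul]
      gcongr
      exact not_lt.1 hx
    calc _ ≤ D := by simp only [D]; gcongr
      _ ≤ D * ((1 + a) ^ 6 * (1 / (1 + ‖x‖) ^ 6)) := le_mul_of_one_le_right hD h2
      _ = D * (1 + a) ^ 6 * (1 / (1 + ‖x‖) ^ 6) := by ring
      _ ≤ _ := le_add_of_nonneg_right (by positivity)

/-- Splitting the potential at the cutoff only increases the edge factor of the tree-graph inequality,
because `t ↦ 1 - exp (-t)` is subadditive and both parts are nonnegative inside the cutoff radius. -/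
theorem one_sub_exp_le_ctildeIntegrand {a β : ℝ} (ha : 0 < a) (ha6 : 2 * a ^ 6 ≤ 1) (hβ : 0 ≤ β)
    (x : Space) : 1 - Real.exp (-|β * lennardJones ‖x‖|) ≤ ctildeIntegrand a β x := by
  rcases (norm_nonneg x).eq_or_lt with h0 | h0
  · -- The junk value of the potential at the origin is `0`, and the left side vanishes.
    rw [← h0]
    simpa [lennardJones] using ctildeIntegrand_nonneg hβ x
  have hlin : ∀ t : ℝ, 1 - Real.exp (-t) ≤ t := fun t => by
    linarith [Real.add_one_le_exp (-t)]
  unfold ctildeIntegrand cutoffLJ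
  by_cases hx : a < ‖x‖
  · simp only [hx, if_true, sub_self, mul_zero, Real.exp_zero, abs_zero, zero_add]
    rw [abs_mul, abs_of_nonneg hβ]
    exact hlin _
  · simp only [hx, if_false]
    have hxa : ‖x‖ ≤ a := not_lt.1 hx
    have hua : 2 ≤ 1 / a ^ 6 := by
      rw [le_div_iff₀ (by positivity)]
      exact ha6
    have hux : 1 / a ^ 6 ≤ 1 / ‖x‖ ^ 6 := by gcongr
    have hVa : 0 ≤ lennardJones a := by
      rw [lennardJones_eq]; nlinarith
    have hV : lennardJones a ≤ lennardJones ‖x‖ := by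
      rw [lennardJones_eq, lennardJones_eq]; nlinarith
    set s := β * (lennardJones ‖x‖ - lennardJones a) with hs
    set t := β * lennardJones a with ht
    have hs0 : 0 ≤ s := mul_nonneg hβ (by linarith)
    have ht0 : 0 ≤ t := mul_nonneg hβ hVa
    have hst : β * lennardJones ‖x‖ = s + t := by rw [hs, ht]; ring
    have h1 : |Real.exp (-β * (lennardJones ‖x‖ - lennardJones a)) - 1| = 1 - Real.exp (-s) := by
      rw [neg_mul, ← hs, abs_sub_comm, abs_of_nonneg]
      linarith [Real.exp_le_one_iff.2 (neg_nonpos.2 hs0)]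
    rw [h1, hst, abs_of_nonneg (add_nonneg hs0 ht0), abs_of_nonneg hVa, ← ht, neg_add, Real.exp_add]
    have := hlin t
    have := Real.exp_le_one_iff.2 (neg_nonpos.2 hs0)
    have := Real.exp_le_one_iff.2 (neg_nonpos.2 ht0)
    have := Real.exp_pos (-s)
    nlinarith

/-- Configurations with coinciding points form a finite union of proper subspaces. -/
theorem ae_injective (n : ℕ) : ∀ᵐ x : Fin n → Space, Function.Injective x := by
  have h : ∀ i j : Fin n, i ≠ j → ∀ᵐ x : Fin n → Space, x i ≠ x j := by
    intro i j hij
    let W : Submodule ℝ (Fin n → Space) :=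
      LinearMap.ker (LinearMap.proj (R := ℝ) (φ := fun _ : Fin n => Space) i - LinearMap.proj j)
    have hW : W ≠ ⊤ := by
      intro hW
      obtain ⟨y, hy⟩ := exists_ne (0 : Space)
      have : Function.update (0 : Fin n → Space) i y ∈ W := hW ▸ Submodule.mem_top
      simp [W, hij.symm] at this
      exact hy this
    refine measure_mono_null ?_ (Measure.addHaar_submodule volume W hW)
    intro x hx
    simpa [W, sub_eq_zero] using hx
  have h' : ∀ᵐ x : Fin n → Space, ∀ i j : Fin n, i ≠ j → x i ≠ x j := by
    simp only [ae_all_iff]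
    exact h
  filter_upwards [h'] with x hx i j hij
  by_contra hne
  exact hx i j hne hij

section Bound

variable {a β : ℝ} {Λ : Set Space} {n : ℕ}

/-- The edge factor `1 - exp (-|β V|)` of the tree-graph inequality, as a kernel on `ℝ³`. -/
noncomputable def edgeKernel (β : ℝ) (y z : Space) : ENNReal :=
  ENNReal.ofReal (1 - Real.exp (-|β * lennardJones ‖y - z‖|))

theorem lintegral_edgeKernel_le (ha : 0 < a) (ha6 : 2 * a ^ 6 ≤ 1) (hβ : 0 ≤ β) (z : Space) :
    ∫⁻ y in Λ, edgeKernel β y z ≤ ENNReal.ofReal (ctilde a β) := by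
  rw [ctilde, ofReal_integral_eq_lintegral_ofReal (integrable_ctildeIntegrand ha hβ)
    (Filter.Eventually.of_forall (ctildeIntegrand_nonneg hβ))]
  calc ∫⁻ y in Λ, edgeKernel β y z ≤ ∫⁻ y, edgeKernel β y z := setLIntegral_le_lintegral _ _
    _ = ∫⁻ y : Space, ENNReal.ofReal (1 - Real.exp (-|β * lennardJones ‖y‖|)) :=
        lintegral_sub_right_eq_self
          (fun y : Space => ENNReal.ofReal (1 - Real.exp (-|β * lennardJones ‖y‖|))) z
    _ ≤ _ := lintegral_mono fun y =>
        ENNReal.ofReal_le_ofReal (one_sub_exp_le_ctildeIntegrand ha ha6 hβ y)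

theorem card_trees_le (hn : 1 ≤ n) (S : Finset (Finset (Fin n × Fin n)))
    (hS : ∀ F ∈ S, F ⊆ orderedPairs n ∧ (pairGraph F).IsTree) :
    (S.card : ℝ) ≤ (n : ℝ) ^ ((n : ℤ) - 2) := by
  classical
  have h := card_trees_mul_card_le (S.image pairGraph) fun G hG => by
    obtain ⟨F, hF, rfl⟩ := Finset.mem_image.1 hG
    exact (hS F hF).2
  rw [Finset.card_image_of_injOn ((pairGraph_injOn n).mono fun F hF => (hS F hF).1),
    Fintype.card_fin] at h
  have hn0 : (0 : ℝ) < n := by exact_mod_cast hn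
  have hpow : (n : ℝ) ^ ((n : ℤ) - 2) = (n : ℝ) ^ (n - 1) / n := by
    rw [eq_div_iff hn0.ne', ← zpow_add_one₀ hn0.ne', ← zpow_natCast]
    congr 1
    omega
  rw [hpow, le_div_iff₀ hn0]
  exact_mod_cast h

theorem lintegral_abs_mayerIntegrand_le (ha : 0 < a) (ha6 : 2 * a ^ 6 ≤ 1) (hβ : 0 ≤ β)
    (h0 : 0 < volume Λ) (h1 : volume Λ < ⊤) (hn : 1 ≤ n) :
    ∫⁻ x in Set.univ.pi fun _ => Λ, ENNReal.ofReal |mayerIntegrand lennardJones β n x| ≤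
      ENNReal.ofReal (Real.exp (β * ljStabilityConst * n) * (n : ℝ) ^ ((n : ℤ) - 2) *
        ctilde a β ^ (n - 1) * volume.real Λ) := by
  classical
  have hC0 : 0 ≤ ctilde a β := integral_nonneg (ctildeIntegrand_nonneg hβ)
  have hfin : IsFiniteMeasure (volume.restrict Λ) := ⟨by simpa using h1⟩
  have hν : volume.restrict Λ ≠ 0 := by
    rw [Ne, Measure.restrict_eq_zero]
    exact h0.ne'
  have hk : Measurable fun q : Space × Space => edgeKernel β q.1 q.2 := by
    have : Measurable fun q : Space × Space => lennardJones ‖q.1 - q.2‖ :=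
      measurable_lennardJones.comp (by fun_prop)
    exact (((this.const_mul β).abs.neg.exp).const_sub 1).ennreal_ofReal
  have hsymm : ∀ y z, edgeKernel β y z = edgeKernel β z y := fun y z => by
    rw [edgeKernel, norm_sub_rev, edgeKernel]
  let S : Finset (Finset (Fin n × Fin n)) :=
    (orderedPairs n).powerset.filter fun F => (pairGraph F).IsTree
  have hS : ∀ F ∈ S, F ⊆ orderedPairs n ∧ (pairGraph F).IsTree := fun F hF => by
    simpa [S] using hF
  have htree : ∀ x : Fin n → Space,
      ENNReal.ofReal (treeSum (fun p => β * lennardJones ‖x p.1 - x p.2‖) ⊥ (orderedPairs n)) =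
        ∑ F ∈ S, ∏ e ∈ F, edgeKernel β (x e.1) (x e.2) := by
    intro x
    rw [treeSum_eq_sum_filter, ENNReal.ofReal_sum_of_nonneg]
    · refine Finset.sum_congr (by simp [S]) fun F _ => ?_
      rw [ENNReal.ofReal_prod_of_nonneg fun e _ => one_sub_exp_neg_abs_nonneg _]
      rfl
    · exact fun F _ => Finset.prod_nonneg fun e _ => one_sub_exp_neg_abs_nonneg _
  have hmeas : ∀ F : Finset (Fin n × Fin n),
      Measurable fun x : Fin n → Space => ∏ e ∈ F, edgeKernel β (x e.1) (x e.2) := fun F =>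
    Finset.measurable_fun_prod _ fun e _ =>
      hk.comp (f := fun x : Fin n → Space => (x e.1, x e.2)) (by fun_prop)
  have hrestrict : (volume : Measure (Fin n → Space)).restrict (Set.univ.pi fun _ => Λ) =
      Measure.pi fun _ => volume.restrict Λ := by
    rw [volume_pi, Measure.restrict_pi_pi]
  calc ∫⁻ x in Set.univ.pi fun _ => Λ, ENNReal.ofReal |mayerIntegrand lennardJones β n x|
      ≤ ∫⁻ x in Set.univ.pi fun _ => Λ, ENNReal.ofReal (Real.exp (β * ljStabilityConst * n)) *
          ∑ F ∈ S, ∏ e ∈ F, edgeKernel β (x e.1) (x e.2) := by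
        refine lintegral_mono_ae ?_
        filter_upwards [ae_restrict_of_ae (ae_injective n)] with x hx
        rw [← htree, ← ENNReal.ofReal_mul (Real.exp_pos _).le]
        exact ENNReal.ofReal_le_ofReal (abs_mayerIntegrand_le hβ hx)
    _ = ENNReal.ofReal (Real.exp (β * ljStabilityConst * n)) *
          ∑ F ∈ S, ∫⁻ x, ∏ e ∈ F, edgeKernel β (x e.1) (x e.2)
            ∂Measure.pi fun _ => volume.restrict Λ := by
        rw [lintegral_const_mul _ (Finset.measurable_fun_sum _ fun F _ => hmeas F),
          lintegral_finsetSum _ fun F _ => hmeas F, hrestrict]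
    _ ≤ ENNReal.ofReal (Real.exp (β * ljStabilityConst * n)) *
          ∑ _F ∈ S, ENNReal.ofReal (ctilde a β) ^ (n - 1) * volume Λ := by
        gcongr with F hF
        have := lintegral_prod_tree_le hn (volume.restrict Λ) hν hk hsymm
          (lintegral_edgeKernel_le ha ha6 hβ) (hS F hF).1 (hS F hF).2
        rwa [Measure.restrict_apply_univ] at this
    _ = ENNReal.ofReal (Real.exp (β * ljStabilityConst * n) * S.card *
          ctilde a β ^ (n - 1) * volume.real Λ) := by
        rw [Finset.sum_const, nsmul_eq_mul, ENNReal.ofReal_mul (by positivity),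
          ENNReal.ofReal_mul (by positivity), ENNReal.ofReal_mul (by positivity),
          ENNReal.ofReal_natCast, ENNReal.ofReal_pow hC0, ofReal_measureReal h1.ne]
        ring
    _ ≤ _ := by
        refine ENNReal.ofReal_le_ofReal ?_
        gcongr
        exact card_trees_le hn S hS

theorem integrableOn_mayerIntegrand (ha : 0 < a) (ha6 : 2 * a ^ 6 ≤ 1) (hβ : 0 ≤ β)
    (h0 : 0 < volume Λ) (h1 : volume Λ < ⊤) (hn : 1 ≤ n) :
    IntegrableOn (mayerIntegrand lennardJones β n) (Set.univ.pi fun _ => Λ) volume := by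
  refine ⟨(measurable_mayerIntegrand β n).aestronglyMeasurable, ?_⟩
  rw [hasFiniteIntegral_iff_norm]
  exact (lintegral_abs_mayerIntegrand_le ha ha6 hβ h0 h1 hn).trans_lt ENNReal.ofReal_lt_top

theorem abs_mayerCoeff_le (ha : 0 < a) (ha6 : 2 * a ^ 6 ≤ 1) (hβ : 0 ≤ β)
    (h0 : 0 < volume Λ) (h1 : volume Λ < ⊤) (hn : 1 ≤ n) :
    |mayerCoeff lennardJones β Λ n| ≤ Real.exp (β * ljStabilityConst * n) *
      (n : ℝ) ^ ((n : ℤ) - 2) * (ctilde a β ^ (n - 1) / (n.factorial : ℝ)) := by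
  have hC0 : 0 ≤ ctilde a β := integral_nonneg (ctildeIntegrand_nonneg hβ)
  have hΛ : 0 < volume.real Λ := ENNReal.toReal_pos h0.ne' h1.ne
  have hint : |∫ x in Set.univ.pi fun _ : Fin n => Λ, mayerIntegrand lennardJones β n x| ≤
      Real.exp (β * ljStabilityConst * n) * (n : ℝ) ^ ((n : ℤ) - 2) *
        ctilde a β ^ (n - 1) * volume.real Λ := by
    rw [← Real.norm_eq_abs]
    refine (norm_integral_le_lintegral_norm (mayerIntegrand lennardJones β n)).trans ?_
    exact ENNReal.toReal_le_of_le_ofReal (by positivity)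
      (lintegral_abs_mayerIntegrand_le ha ha6 hβ h0 h1 hn)
  unfold mayerCoeff
  rw [abs_mul, abs_of_nonneg (by positivity)]
  calc _ ≤ 1 / volume.real Λ * (1 / (n.factorial : ℝ)) *
        (Real.exp (β * ljStabilityConst * n) * (n : ℝ) ^ ((n : ℤ) - 2) *
          ctilde a β ^ (n - 1) * volume.real Λ) := by gcongr
    _ = _ := by field_simp

/-- The majorant of the Mayer series is geometric, since `n ^ (n - 2) / n! ≤ exp n`. -/
theorem norm_mayerCoeff_mul_pow_le (ha : 0 < a) (ha6 : 2 * a ^ 6 ≤ 1) (hβ : 0 ≤ β)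
    (hC : 0 < ctilde a β) (h0 : 0 < volume Λ) (h1 : volume Λ < ⊤) (hn : 1 ≤ n) (z : ℂ) :
    ‖(mayerCoeff lennardJones β Λ n : ℂ) * z ^ n‖ ≤
      1 / ctilde a β * (Real.exp (β * ljStabilityConst + 1) * ctilde a β * ‖z‖) ^ n := by
  have hn1 : (1 : ℝ) ≤ n := by exact_mod_cast hn
  have hzpow : (n : ℝ) ^ ((n : ℤ) - 2) ≤ Real.exp n * n.factorial := by
    calc (n : ℝ) ^ ((n : ℤ) - 2) ≤ (n : ℝ) ^ (n : ℤ) := by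
          exact zpow_le_zpow_right₀ hn1 (by omega)
      _ = (n : ℝ) ^ n := zpow_natCast _ _
      _ ≤ _ := by
          rw [← div_le_iff₀ (by positivity)]
          exact Real.pow_div_factorial_le_exp _ (by positivity) n
  have hexp : Real.exp (β * ljStabilityConst + 1) ^ n =
      Real.exp (β * ljStabilityConst * n) * Real.exp n := by
    rw [← Real.exp_nat_mul, ← Real.exp_add]
    congr 1
    ring
  have hCn : ctilde a β ^ n = ctilde a β ^ (n - 1) * ctilde a β := by
    rw [← pow_succ, Nat.sub_add_cancel hn]
  rw [norm_mul, norm_pow, Complex.norm_real, Real.norm_eq_abs]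
  calc |mayerCoeff lennardJones β Λ n| * ‖z‖ ^ n
      ≤ Real.exp (β * ljStabilityConst * n) * (Real.exp n * n.factorial) *
          (ctilde a β ^ (n - 1) / (n.factorial : ℝ)) * ‖z‖ ^ n := by
        gcongr
        exact (abs_mayerCoeff_le ha ha6 hβ h0 h1 hn).trans (by gcongr)
    _ = _ := by
        rw [mul_pow, mul_pow, hexp, hCn]
        field_simp

end Bound

theorem theorem3 :
    -- the Lennard-Jones potential is stable, and its stability constant is the minimal one
    IsLeast ljStabilityBounds ljStabilityConst ∧
    -- a cutoff exists, and the value 0.3637 can be taken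
    ∃ a : ℝ, a = 0.3637 ∧ 0 < a ∧ a < (2 : ℝ) ^ (-(1 / 6) : ℝ) ∧
      ∀ β : ℝ, 0 < β →
        -- the integral that defines `ctilde a β` converges
        Integrable (ctildeIntegrand a β) volume ∧
        -- the bound on the Mayer coefficients
        (∀ Λ : Set Space, MeasurableSet Λ → 0 < volume Λ → volume Λ < ⊤ →
          ∀ n : ℕ, 1 ≤ n →
            IntegrableOn (mayerIntegrand lennardJones β n) (Set.univ.pi fun _ => Λ) volume ∧
            |mayerCoeff lennardJones β Λ n| ≤
              Real.exp (β * ljStabilityConst * n) * (n : ℝ) ^ ((n : ℤ) - 2) *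
                (ctilde a β ^ (n - 1) / (n.factorial : ℝ))) ∧
        -- absolute convergence of the Mayer series, uniformly in `Λ`:
        -- there is a summable majorant that does not depend on `Λ`
        (∀ z : ℂ, ‖z‖ < 1 / (Real.exp (β * ljStabilityConst + 1) * ctilde a β) →
          ∃ M : ℕ → ℝ, Summable M ∧
            ∀ Λ : Set Space, MeasurableSet Λ → 0 < volume Λ → volume Λ < ⊤ →
              ∀ n : ℕ, 1 ≤ n → ‖(mayerCoeff lennardJones β Λ n : ℂ) * z ^ n‖ ≤ M n) := by
  refine ⟨isLeast_ljStabilityConst, 0.3637, rfl, by norm_num, ?_, fun β hβ => ?_⟩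
  · rw [← pow_lt_pow_iff_left₀ (by norm_num) (by positivity) (show (6 : ℕ) ≠ 0 by norm_num),
      ← Real.rpow_natCast, ← Real.rpow_natCast, ← Real.rpow_mul (by norm_num)]
    norm_num
  have ha : (0 : ℝ) < 0.3637 := by norm_num
  have ha6 : 2 * (0.3637 : ℝ) ^ 6 ≤ 1 := by norm_num
  refine ⟨integrable_ctildeIntegrand ha hβ.le, fun Λ _ h0 h1 n hn =>
    ⟨integrableOn_mayerIntegrand ha ha6 hβ.le h0 h1 hn,
      abs_mayerCoeff_le ha ha6 hβ.le h0 h1 hn⟩, fun z hz => ?_⟩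
  have hden : 0 < Real.exp (β * ljStabilityConst + 1) * ctilde 0.3637 β :=
    one_div_pos.1 ((norm_nonneg z).trans_lt hz)
  have hC : 0 < ctilde 0.3637 β := pos_of_mul_pos_right hden (Real.exp_pos _).le
  rw [lt_div_iff₀ hden, mul_comm] at hz
  exact ⟨_, (summable_geometric_of_lt_one (by positivity) hz).mul_left _,
    fun Λ _ h0 h1 n hn => norm_mayerCoeff_mul_pow_le ha ha6 hβ.le hC h0 h1 hn z⟩
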